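/- Let $K$ be a field of characteristic different from $2$ and let $n$ be an even positive integer. Let $(Q_1,\sigma_1),\dots,(Q_n,\sigma_n)$ be quaternion algebras over $K$ with involutions of the first kind (i.e. $K$-linear anti-automorphisms with $\sigma_i^2=\mathrm{id}$), and let $$(A,\sigma)=(Q_1,\sigma_1)\otimes_K\cdots\otimes_K(Q_n,\sigma_n).$$ Call $\sigma$ orthogonal (respectively symplectic) if, after extending scalars to a splitting field of $A$, it becomes the adjoint involution of a nondegenerate symmetric (respectively alternating) bilinear form. For a nondegenerate finite-dimensional quadratic space $(V,q)$ over $K$ and an isometry $s$ of $(V,q)$ with $s^2=\mathrm{id}$ (an orthogonal symmetry), let $J_q^s$ denote the unique $K$-linear involution of the Clifford algebra $C(V,q)$ (in which $x^2=q(x)$ for $x\in V$) with $J_q^s(x)=s(x)$ for all $x\in V$. A reflection is an orthogonal symmetry $\tau$ whose fixed space $\{x\in V:\tau(x)=x\}$ is a hyperplane of $V$. Isomorphisms below are isomorphisms of $K$-algebras with involution. Then: (a) If $n\equiv 0\pmod 4$ and $\sigma$ is orthogonal, there exist nondegenerate quadratic spaces $(V,q)$ and $(V',q')$ of dimension $2n$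 over $K$ such that $(A,\sigma)\simeq(C(V,q),J_q^{\mathrm{id}})$ and $(A,\sigma)\simeq(C(V',q'),J_{q'}^{-\mathrm{id}})$. (b) If $n\equiv 0\pmod 4$ and $\sigma$ is symplectic, there exist a nondegenerate quadratic space $(V,q)$ of dimension $2n$ over $K$ and a reflection $\tau$ of $(V,q)$ such that $(A,\sigma)\simeq(C(V,q),J_q^{\tau})$. (c) If $n\equiv 2\pmod 4$ and $\sigma$ is symplectic, there exist nondegenerate quadratic spaces $(V,q)$ and $(V',q')$ of dimension $2n$ over $K$ such that $(A,\sigma)\simeq(C(V,q),J_q^{\mathrm{id}})$ and $(A,\sigma)\simeq(C(V',q'),J_{q'}^{-\mathrm{id}})$. (d) If $n\equiv 2\pmod 4$ and $\sigma$ is orthogonal, there exist a nondegenerate quadratic space $(V,q)$ of dimension $2n$ over $K$ and a reflection $\tau$ of $(V,q)$ such that $(A,\sigma)\simeq(C(V,q),J_q^{\tau})$. -/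

import Mathlib

open scoped TensorProduct Quaternion

universe u v

noncomputable section

/-- An involution of the first kind on a `K`-algebra `A` (a `K`-involution): a `K`-linear map
`σ : A → A` with `σ (x y) = σ y σ x` and `σ (σ x) = x`. Linearity over `K` says that `σ` fixes
`K` elementwise. -/
structure KInvolution (K A : Type*) [CommRing K] [Ring A] [Algebra K A] extends A →ₗ[K] A where
  map_mul_rev : ∀ x y : A, toFun (x * y) = toFun y * toFun x
  invol : ∀ x : A, toFun (toFun x) = x

namespace KInvolution

/-- Isomorphism of `K`-algebras with involution, `(A, σ) ≃ (B, τ)`. -/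
def Isomorphic {K A B : Type*} [CommRing K] [Ring A] [Algebra K A] [Ring B] [Algebra K B]
    (σ : KInvolution K A) (τ : KInvolution K B) : Prop :=
  ∃ f : A ≃ₐ[K] B, ∀ x : A, f (σ.toLinearMap x) = τ.toLinearMap (f x)

/-- The involution `σ₁ ⊗ ⋯ ⊗ σₙ` on `A₁ ⊗ ⋯ ⊗ Aₙ`. -/
def piTensor {K : Type*} [CommRing K] {ι : Type*} {A : ι → Type*} [∀ i, Ring (A i)]
    [∀ i, Algebra K (A i)] (σ : ∀ i, KInvolution K (A i)) : KInvolution K (⨂[K] i, A i) where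
  toLinearMap := PiTensorProduct.map fun i => (σ i).toLinearMap
  map_mul_rev := by
    intro x y
    change PiTensorProduct.map (fun i => (σ i).toLinearMap) (x * y) =
      PiTensorProduct.map (fun i => (σ i).toLinearMap) y *
        PiTensorProduct.map (fun i => (σ i).toLinearMap) x
    induction x using PiTensorProduct.induction_on with
    | add x₁ x₂ h₁ h₂ => rw [add_mul, map_add, map_add, mul_add, h₁, h₂]
    | smul_tprod r a =>
      induction y using PiTensorProduct.induction_on with
      | add y₁ y₂ h₁ h₂ => rw [mul_add, map_add, map_add, add_mul, h₁, h₂]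
      | smul_tprod s b =>
        simp only [smul_mul_assoc, mul_smul_comm, PiTensorProduct.tprod_mul_tprod, map_smul,
          PiTensorProduct.map_tprod]
        rw [smul_comm]
        congr 3
        funext i
        exact (σ i).map_mul_rev (a i) (b i)
  invol := by
    intro x
    change PiTensorProduct.map (fun i => (σ i).toLinearMap)
      (PiTensorProduct.map (fun i => (σ i).toLinearMap) x) = x
    induction x using PiTensorProduct.induction_on with
    | add x₁ x₂ h₁ h₂ => rw [map_add, map_add, h₁, h₂]
    | smul_tprod r a =>
      simp only [map_smul, PiTensorProduct.map_tprod]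
      congr 2
      funext i
      exact (σ i).invol (a i)

/-- `σ` becomes adjoint to the bilinear form `b` on the `L`-space `V` after extending scalars to
`L`, which splits `A` through the given isomorphism `φ : L ⊗ A ≃ End_L V`: for all `a`, the
operator `φ (σ_L a)` is the adjoint of `φ a` with respect to `b`. -/
def IsAdjointVia {K A L V : Type*} [Field K] [Ring A] [Algebra K A] [Field L] [Algebra K L]
    [AddCommGroup V] [Module L V] (σ : KInvolution K A) (φ : L ⊗[K] A ≃ₐ[L] Module.End L V)
    (b : LinearMap.BilinForm L V) : Prop :=
  ∀ (a : L ⊗[K] A) (x y : V), b x (φ a y) = b (φ (σ.toLinearMap.baseChange L a) x) y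

/-- A `K`-involution on a central simple algebra (characteristic not two) is *orthogonal* if
over some splitting field it is the adjoint involution of a nondegenerate symmetric bilinear
form. -/
def IsOrthogonal {K : Type u} {A : Type v} [Field K] [Ring A] [Algebra K A]
    (σ : KInvolution K A) : Prop :=
  ∃ (L : Type u) (_ : Field L) (_ : Algebra K L) (V : Type u) (_ : AddCommGroup V)
    (_ : Module L V) (_ : Module.Finite L V) (φ : L ⊗[K] A ≃ₐ[L] Module.End L V)
    (b : LinearMap.BilinForm L V), b.Nondegenerate ∧ b.IsSymm ∧ σ.IsAdjointVia φ b

/-- A `K`-involution on a central simple algebra (characteristic not two) is *symplectic* if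
over some splitting field it is the adjoint involution of a nondegenerate alternating bilinear
form. -/
def IsSymplectic {K : Type u} {A : Type v} [Field K] [Ring A] [Algebra K A]
    (σ : KInvolution K A) : Prop :=
  ∃ (L : Type u) (_ : Field L) (_ : Algebra K L) (V : Type u) (_ : AddCommGroup V)
    (_ : Module L V) (_ : Module.Finite L V) (φ : L ⊗[K] A ≃ₐ[L] Module.End L V)
    (b : LinearMap.BilinForm L V), b.Nondegenerate ∧ b.IsAlt ∧ σ.IsAdjointVia φ b

end KInvolution

/-- Quaternion algebras over a field of characteristic not two: `Q ≃ (a, b)_K` with `a, b ≠ 0`,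
generated by `i, j` with `i² = a`, `j² = b`, `ij = -ji`. -/
def IsQuaternionAlgebra (K Q : Type*) [Field K] [Ring Q] [Algebra K Q] : Prop :=
  ∃ a b : K, a ≠ 0 ∧ b ≠ 0 ∧ Nonempty (Q ≃ₐ[K] ℍ[K,a,b])

/-- An orthogonal symmetry of `(V, q)`: an isometry `s` of `(V, q)` with `s² = id`. -/
structure OrthogonalSymmetry {K V : Type*} [Field K] [AddCommGroup V] [Module K V]
    (q : QuadraticForm K V) extends q →qᵢ q where
  invol : ∀ x : V, toFun (toFun x) = x

namespace OrthogonalSymmetry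

variable {K V : Type*} [Field K] [AddCommGroup V] [Module K V] {q : QuadraticForm K V}

/-- The orthogonal symmetry `id`. -/
def id (q : QuadraticForm K V) : OrthogonalSymmetry q where
  toLinearMap := LinearMap.id
  map_app' _ := rfl
  invol _ := rfl

/-- The orthogonal symmetry `-id`. -/
def negId (q : QuadraticForm K V) : OrthogonalSymmetry q where
  toLinearMap := -LinearMap.id
  map_app' x := by simp
  invol x := by simp

/-- The invariant subspace `V⁺ = {x | s x = x}`. -/
def fixedSubspace (s : OrthogonalSymmetry q) : Submodule K V :=
  LinearMap.eqLocus s.toLinearMap LinearMap.id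

/-- A reflection is an orthogonal symmetry whose invariant subspace is a hyperplane. -/
def IsReflection (s : OrthogonalSymmetry q) : Prop :=
  Module.finrank K s.fixedSubspace + 1 = Module.finrank K V

/-- The involution `J_q^s` of the Clifford algebra `C(V, q)`, with `J_q^s (ι x) = ι (s x)`: the
automorphism induced by `s` followed by the reversion. -/
def cliffordInvolution (s : OrthogonalSymmetry q) : KInvolution K (CliffordAlgebra q) where
  toLinearMap := CliffordAlgebra.reverse ∘ₗ (CliffordAlgebra.map s.toIsometry).toLinearMap
  map_mul_rev x y := by
    simp
  invol x := by
    change CliffordAlgebra.reverse (CliffordAlgebra.map s.toIsometry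
      (CliffordAlgebra.reverse (CliffordAlgebra.map s.toIsometry x))) = x
    induction x using CliffordAlgebra.induction with
    | algebraMap r => simp
    | ι x =>
      simp only [CliffordAlgebra.map_apply_ι, CliffordAlgebra.reverse_ι]
      congr 1
      exact s.invol x
    | mul a b ha hb => simp only [map_mul, CliffordAlgebra.reverse.map_mul, ha, hb]
    | add a b ha hb => simp only [map_add, ha, hb]

/-- The property that characterizes `J_q^s` among the `K`-involutions of `C(V, q)`. -/
theorem cliffordInvolution_ι (s : OrthogonalSymmetry q) (x : V) :
    s.cliffordInvolution.toLinearMap (CliffordAlgebra.ι q x) =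
      CliffordAlgebra.ι q (s.toLinearMap x) := by
  change CliffordAlgebra.reverse (CliffordAlgebra.map s.toIsometry (CliffordAlgebra.ι q x)) = _
  simp only [CliffordAlgebra.map_apply_ι, CliffordAlgebra.reverse_ι]
  rfl

end OrthogonalSymmetry

/-- There is a nondegenerate quadratic space `(V, q)` of dimension `d` over `K` with
`(A, σ) ≃ (C(V, q), J_q^id)`. -/
def IsCliffordId {K : Type u} {A : Type v} [Field K] [Ring A] [Algebra K A] (d : ℕ)
    (σ : KInvolution K A) : Prop :=
  ∃ (V : Type u) (_ : AddCommGroup V) (_ : Module K V) (q : QuadraticForm K V),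
    Module.Finite K V ∧ Module.finrank K V = d ∧ (QuadraticMap.polarBilin q).Nondegenerate ∧
      σ.Isomorphic (OrthogonalSymmetry.id q).cliffordInvolution

/-- There is a nondegenerate quadratic space `(V, q)` of dimension `d` over `K` with
`(A, σ) ≃ (C(V, q), J_q^{-id})`. -/
def IsCliffordNegId {K : Type u} {A : Type v} [Field K] [Ring A] [Algebra K A] (d : ℕ)
    (σ : KInvolution K A) : Prop :=
  ∃ (V : Type u) (_ : AddCommGroup V) (_ : Module K V) (q : QuadraticForm K V),
    Module.Finite K V ∧ Module.finrank K V = d ∧ (QuadraticMap.polarBilin q).Nondegenerate ∧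
      σ.Isomorphic (OrthogonalSymmetry.negId q).cliffordInvolution

/-- There are a nondegenerate quadratic space `(V, q)` of dimension `d` over `K` and a reflection
`τ` of `(V, q)` with `(A, σ) ≃ (C(V, q), J_q^τ)`. -/
def IsCliffordReflection {K : Type u} {A : Type v} [Field K] [Ring A] [Algebra K A] (d : ℕ)
    (σ : KInvolution K A) : Prop :=
  ∃ (V : Type u) (_ : AddCommGroup V) (_ : Module K V) (q : QuadraticForm K V),
    Module.Finite K V ∧ Module.finrank K V = d ∧ (QuadraticMap.polarBilin q).Nondegenerate ∧
      ∃ τ : OrthogonalSymmetry q, τ.IsReflection ∧ σ.Isomorphic τ.cliffordInvolution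

end

/-!
Every involution of the first kind of a quaternion algebra `Q` is diagonal in some quaternion basis
`1, x, y, xy`, and this basis can be chosen so that `x` and `y` have the same sign; then `xy` is
skew-symmetric. Indexing the basis by exponents in `𝔽₂²`, the signs are the values of the quadratic
form `p₁ p₂ + t (p₁ + p₂)`, whose polar form `ω` records which basis elements anticommute; `t` is
`0` or `1` according as the involution is orthogonal or symplectic. The tensor product
`A = Q₁ ⊗ ⋯ ⊗ Qₙ` inherits a basis `e v`, `v ∈ (𝔽₂²)ⁿ`, with `σ (e v) = ± e v`, the sign being the
value at `v` of the orthogonal sum of these quadratic forms (`IsPauliBasis.piTensor`). The problem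
becomes one about this quadratic form over `𝔽₂`, with Arf invariant `∑ tₖ`.

The Arf invariant is read off from the type of `σ`: the trace of the linear map `σ` is
`(-1) ^ ∑ tₖ * 2 ^ n`, while the trace of the adjoint involution of an `ε`-symmetric form on a space
of dimension `2 ^ n` is `ε 2 ^ n` (`IsPauliBasis.signChar_sum_eq`).

If `2n` vectors `v a` satisfy `ω (v a) (v b) = 1` for `a ≠ b`, the elements `e (v a)` anticommute
pairwise and have nonzero scalar squares, so they define a homomorphism to `A` from the Clifford
algebra of a diagonal form of dimension `2n`. The vectors are a basis, since their Gram matrix is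
invertible, so the homomorphism is surjective, hence bijective as both algebras have dimension
`4 ^ n` (`IsPauliBasis.exists_cliffordEquiv`). The involution is identified by its signs on the
`e (v a)`.

Such vectors come from a tournament on the `n` factors: the two vectors of vertex `m` are `(1, 0)`
and `(0, 1)` in the plane `m`, plus `(1, 1)` in each plane `k` with an edge from `m` to `k`. Both
have sign `tₘ` plus the out-degree of `m`, and the parities of the out-degrees are arbitrary except
that they add up to `n (n - 1) / 2` (`exists_tournament`). If `∑ tₖ` has this parity, the signs can
be made all `+` or all `-`, which gives the involutions of `id` and `-id`. Otherwise they can be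
made all `+` except at one vertex, and replacing one of its two vectors by the vector with all
components `(1, 1)` leaves exactly one sign `-`, which gives a reflection.
-/

noncomputable section

/-- The sign character `ZMod 2 → {1, -1}` with values in `K`. -/
def signChar (K : Type*) [Field K] (a : ZMod 2) : K := if a = 0 then 1 else -1

/-! ### Signs and elements of `𝔽₂` -/

section SignChar

variable {K : Type*} [Field K]

@[simp] theorem signChar_zero : signChar K 0 = 1 := if_pos rfl

@[simp] theorem signChar_one : signChar K 1 = -1 := if_neg one_ne_zero

theorem ZMod.eq_zero_or_eq_one (a : ZMod 2) : a = 0 ∨ a = 1 := by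
  fin_cases a
  · exact Or.inl rfl
  · exact Or.inr rfl

theorem signChar_add (a b : ZMod 2) : signChar K (a + b) = signChar K a * signChar K b := by
  have h : (1 + 1 : ZMod 2) = 0 := rfl
  rcases ZMod.eq_zero_or_eq_one a with rfl | rfl <;>
    rcases ZMod.eq_zero_or_eq_one b with rfl | rfl <;> simp [h]

theorem signChar_sum {ι : Type*} (s : Finset ι) (f : ι → ZMod 2) :
    signChar K (∑ i ∈ s, f i) = ∏ i ∈ s, signChar K (f i) := by
  classical
  induction s using Finset.induction_on with
  | empty => simp
  | insert i s hi ih => rw [Finset.sum_insert hi, Finset.prod_insert hi, signChar_add, ih]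

theorem signChar_ne_zero (a : ZMod 2) : signChar K a ≠ 0 := by
  rcases ZMod.eq_zero_or_eq_one a with rfl | rfl <;> simp

theorem signChar_injective (h2 : (2 : K) ≠ 0) : Function.Injective (signChar K) := by
  have h : (1 : K) ≠ -1 := fun h => h2 (by linear_combination h)
  intro a b hab
  rcases ZMod.eq_zero_or_eq_one a with rfl | rfl <;>
    rcases ZMod.eq_zero_or_eq_one b with rfl | rfl <;> simp_all [h.symm]

end SignChar

/-- A basis `(e v)` of a `K`-algebra with involution `(A, σ)`, indexed by an elementary abelian
`2`-group `V`, in which `e v * e w` is a nonzero multiple of `e (v + w)`, the elements `e v` and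
`e w` commute up to the sign given by `ω v w`, and `e v` is symmetric or skew-symmetric for `σ`
according to the value `Q v`. -/
structure IsPauliBasis {K A V : Type*} [Field K] [Ring A] [Algebra K A] [AddCommGroup V]
    (ω : V → V → ZMod 2) (Q : V → ZMod 2) (σ : KInvolution K A) (e : Module.Basis V K A) :
    Prop where
  map_zero : e 0 = 1
  mul (v w : V) : ∃ c : K, c ≠ 0 ∧ e v * e w = c • e (v + w)
  comm (v w : V) : e v * e w = signChar K (ω v w) • (e w * e v)
  map_involution (v : V) : σ.toLinearMap (e v) = signChar K (Q v) • e v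

/-- The alternating form of the hyperbolic plane over `𝔽₂`. -/
def planeForm (p q : ZMod 2 × ZMod 2) : ZMod 2 := p.1 * q.2 + p.2 * q.1

/-- The quadratic form `x y + t (x² + y²)` over `𝔽₂`, written with `x² = x`. It is hyperbolic for
`t = 0` and anisotropic for `t = 1`. -/
def planeQuad (t : ZMod 2) (p : ZMod 2 × ZMod 2) : ZMod 2 := p.1 * p.2 + t * (p.1 + p.2)

theorem KInvolution.map_one {K A : Type*} [CommRing K] [Ring A] [Algebra K A]
    (σ : KInvolution K A) : σ.toLinearMap 1 = 1 := by
  have h := σ.map_mul_rev (σ.toLinearMap 1) 1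
  have h1 : σ.toLinearMap (σ.toLinearMap 1) = 1 := σ.invol 1
  change σ.toLinearMap (σ.toLinearMap 1 * 1) = σ.toLinearMap 1 * σ.toLinearMap _ at h
  rwa [mul_one, h1, mul_one, eq_comm] at h

/-! ### Pauli bases of algebras with two anticommuting generators -/

section Factor

variable {K : Type*} [Field K]

/-- The monomials `1, x, y, x * y` in two elements, indexed by their exponents modulo two. -/
def planeMonomial {B : Type*} [Ring B] (x y : B) (p : ZMod 2 × ZMod 2) : B :=
  (if p.1 = 0 then 1 else x) * (if p.2 = 0 then 1 else y)

theorem linearIndependent_planeMonomial {B : Type*} [Ring B] [Algebra K B] [Nontrivial B]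
    (h2 : (2 : K) ≠ 0) {x y : B} {a b : K} (ha : a ≠ 0) (hb : b ≠ 0)
    (hx : x * x = algebraMap K B a) (hy : y * y = algebraMap K B b) (hxy : x * y = -(y * x)) :
    LinearIndependent K (planeMonomial x y) := by
  rw [Fintype.linearIndependent_iff]
  intro g hg
  rw [Fintype.sum_prod_type] at hg
  have huniv : (Finset.univ : Finset (ZMod 2)) = {0, 1} := rfl
  simp only [huniv, Finset.sum_pair (zero_ne_one (α := ZMod 2)), planeMonomial, if_true,
    one_ne_zero, if_false, one_mul, mul_one] at hg
  obtain ⟨α, hα⟩ : ∃ α, α = g (0, 0) := ⟨_, rfl⟩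
  obtain ⟨β, hβ⟩ : ∃ β, β = g (1, 0) := ⟨_, rfl⟩
  obtain ⟨γ, hγ⟩ : ∃ γ, γ = g (0, 1) := ⟨_, rfl⟩
  obtain ⟨δ, hδ⟩ : ∃ δ, δ = g (1, 1) := ⟨_, rfl⟩
  rw [← hα, ← hβ, ← hγ, ← hδ] at hg
  have cancel : ∀ {c d : K} {z w : B}, c ≠ 0 → z * z = algebraMap K B c →
      d • (z * w) = 0 → d • w = 0 := by
    intro c d z w hc hz h
    have h' : c • d • w = 0 := by
      rw [smul_comm, Algebra.smul_def c, ← hz, mul_assoc, ← mul_smul_comm, h, mul_zero]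
    exact (smul_eq_zero.mp h').resolve_left hc
  -- Commuting with `y` separates the two terms.
  have pair : ∀ {c d : K}, c • (1 : B) + d • x = 0 → c = 0 ∧ d = 0 := by
    intro c d h
    have h₁ : c • y + d • (x * y) = 0 := by
      rw [← zero_mul y, ← h, add_mul, smul_mul_assoc, smul_mul_assoc, one_mul]
    have h₂ : c • y - d • (x * y) = 0 := by
      rw [← mul_zero y, ← h, mul_add, mul_smul_comm, mul_smul_comm, mul_one, hxy]
      module
    have hd : (2 * d) • y = 0 := by
      refine cancel ha hx ?_
      linear_combination (norm := module) h₁ - h₂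
    have hd' : d = 0 := by
      have : (2 * d) • (1 : B) = 0 := by
        refine cancel hb hy ?_
        rw [mul_one, hd]
      simpa [h2] using this
    subst hd'
    simpa using h
  -- Commuting with `x` separates the terms with and without `y`.
  have h₁ : α • x + γ • (x * y) + (β • (x * x) + δ • (x * (x * y))) = 0 := by
    rw [← mul_zero x, ← hg]
    simp only [mul_add, mul_smul_comm, mul_one]
  have h₂ : α • x - γ • (x * y) + (β • (x * x) - δ • (x * (x * y))) = 0 := by
    have hyx : y * x = -(x * y) := by rw [hxy, neg_neg]
    rw [← zero_mul x, ← hg]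
    simp only [add_mul, smul_mul_assoc, one_mul, mul_assoc, hyx, mul_neg]
    module
  have h₃ : (2 : K) • (x * ((γ • 1 + δ • x) * y)) = 0 := by
    simp only [add_mul, smul_mul_assoc, one_mul, mul_add, mul_smul_comm]
    linear_combination (norm := module) h₁ - h₂
  have h₄ : (γ • 1 + δ • x) * y = 0 :=
    (smul_eq_zero.mp (cancel ha hx h₃)).resolve_left h2
  have h₅ : γ • (1 : B) + δ • x = 0 := by
    have : b • (γ • (1 : B) + δ • x) = 0 := by
      rw [Algebra.smul_def, Algebra.commutes, ← hy, ← mul_assoc, h₄, zero_mul]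
    exact (smul_eq_zero.mp this).resolve_left hb
  have h₆ : α • (1 : B) + β • x = 0 := by
    rw [← hg, ← sub_eq_zero, ← neg_eq_zero.mpr h₄]
    simp only [add_mul, smul_mul_assoc, one_mul]
    module
  obtain ⟨hγ0, hδ0⟩ := pair h₅
  obtain ⟨hα0, hβ0⟩ := pair h₆
  rintro ⟨p, q⟩
  rcases ZMod.eq_zero_or_eq_one p with rfl | rfl <;>
    rcases ZMod.eq_zero_or_eq_one q with rfl | rfl
  · rw [← hα, hα0]
  · rw [← hγ, hγ0]
  · rw [← hβ, hβ0]
  · rw [← hδ, hδ0]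

/-- Two anticommuting invertible elements with scalar squares, which an involution `σ` of a
four-dimensional algebra multiplies by the same sign, generate a Pauli basis. -/
theorem exists_isPauliBasis_of_generators {B : Type*} [Ring B] [Algebra K B] [Nontrivial B]
    (h2 : (2 : K) ≠ 0) (σ : KInvolution K B) (hdim : Module.finrank K B = 4) {x y : B} {a b : K}
    (ha : a ≠ 0) (hb : b ≠ 0) (hx : x * x = algebraMap K B a) (hy : y * y = algebraMap K B b)
    (hxy : x * y = -(y * x)) (t : ZMod 2) (hσx : σ.toLinearMap x = signChar K t • x)
    (hσy : σ.toLinearMap y = signChar K t • y) :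
    ∃ e : Module.Basis (ZMod 2 × ZMod 2) K B, IsPauliBasis planeForm (planeQuad t) σ e := by
  have hli := linearIndependent_planeMonomial h2 ha hb hx hy hxy
  let e := basisOfLinearIndependentOfCardEqFinrank hli (by rw [hdim]; rfl)
  have he : ∀ p, e p = planeMonomial x y p := fun p => by simp [e]
  have hyx : y * x = -(x * y) := by rw [hxy, neg_neg]
  have h11 : (1 + 1 : ZMod 2) = 0 := rfl
  let pw (z : B) (p : ZMod 2) : B := if p = 0 then 1 else z
  have hpw : ∀ p q, e (p, q) = pw x p * pw y q := fun p q => he (p, q)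
  have pw_mul : ∀ {z : B} {c : K}, c ≠ 0 → z * z = algebraMap K B c → ∀ p q,
      ∃ d : K, d ≠ 0 ∧ pw z p * pw z q = d • pw z (p + q) := by
    intro z c hc hz p q
    rcases ZMod.eq_zero_or_eq_one p with rfl | rfl <;>
      rcases ZMod.eq_zero_or_eq_one q with rfl | rfl
    · exact ⟨1, one_ne_zero, by simp [pw]⟩
    · exact ⟨1, one_ne_zero, by simp [pw]⟩
    · exact ⟨1, one_ne_zero, by simp [pw]⟩
    · exact ⟨c, hc, by simp [pw, h11, hz, Algebra.algebraMap_eq_smul_one]⟩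
  have pw_comm : ∀ (z : B) p q, pw z p * pw z q = pw z q * pw z p := by
    intro z p q
    rcases ZMod.eq_zero_or_eq_one p with rfl | rfl <;>
      rcases ZMod.eq_zero_or_eq_one q with rfl | rfl <;> simp [pw]
  have pw_swap : ∀ q p, pw y q * pw x p = signChar K (q * p) • (pw x p * pw y q) := by
    intro q p
    rcases ZMod.eq_zero_or_eq_one p with rfl | rfl <;>
      rcases ZMod.eq_zero_or_eq_one q with rfl | rfl <;> simp [pw, hyx]
  have pw_σ : ∀ {z : B}, σ.toLinearMap z = signChar K t • z → ∀ p,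
      σ.toLinearMap (pw z p) = signChar K (t * p) • pw z p := by
    intro z hz p
    rcases ZMod.eq_zero_or_eq_one p with rfl | rfl
    · simp [pw, σ.map_one]
    · simp [pw, hz]
  have e_mul : ∀ p q r s, e (p, q) * e (r, s) =
      signChar K (q * r) • ((pw x p * pw x r) * (pw y q * pw y s)) := by
    intro p q r s
    rw [hpw, hpw, mul_assoc, ← mul_assoc (pw y q), pw_swap]
    simp only [smul_mul_assoc, mul_smul_comm, mul_assoc]
  refine ⟨e, ?_, ?_, ?_, ?_⟩
  · simp [he, planeMonomial]
  · rintro ⟨p, q⟩ ⟨r, s⟩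
    obtain ⟨c, hc, hc'⟩ := pw_mul ha hx p r
    obtain ⟨d, hd, hd'⟩ := pw_mul hb hy q s
    refine ⟨signChar K (q * r) * (c * d), mul_ne_zero (signChar_ne_zero _) (mul_ne_zero hc hd), ?_⟩
    rw [e_mul, hc', hd', Prod.mk_add_mk, hpw, smul_mul_smul_comm, smul_smul]
  · rintro ⟨p, q⟩ ⟨r, s⟩
    rw [e_mul, e_mul, pw_comm x r p, pw_comm y s q, smul_smul, ← signChar_add]
    congr 2
    have h : p * s + p * s = 0 := CharTwo.add_self_eq_zero _
    simp only [planeForm]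
    linear_combination -h
  · rintro ⟨p, q⟩
    have h := σ.map_mul_rev (pw x p) (pw y q)
    change σ.toLinearMap _ = σ.toLinearMap _ * σ.toLinearMap _ at h
    rw [hpw, h, pw_σ hσx, pw_σ hσy, smul_mul_smul_comm, pw_swap, smul_smul, ← signChar_add,
      ← signChar_add]
    congr 2
    simp only [planeQuad]
    ring

end Factor

/-! ### Involutions of quaternion algebras -/

section Quaternion

variable {K : Type*} [Field K]

/-- The square of a pure quaternion, as a scalar. -/
def pureSq {a b : K} (x : ℍ[K,a,b]) : K :=
  a * x.imI ^ 2 + b * x.imJ ^ 2 - a * b * x.imK ^ 2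

theorem mul_self_of_re_eq_zero {a b : K} {x : ℍ[K,a,b]} (hx : x.re = 0) :
    x * x = algebraMap K _ (pureSq x) := by
  ext <;> simp [hx, pureSq, QuaternionAlgebra.algebraMap_eq] <;> ring

/-- An involution of the first kind preserves the pure quaternions: they are `0` and the
noncentral elements with central square. -/
theorem KInvolution.re_eq_zero {a b : K} (h2 : (2 : K) ≠ 0) (σ : KInvolution K ℍ[K,a,b])
    {x : ℍ[K,a,b]} (hx : x.re = 0) : (σ.toLinearMap x).re = 0 := by
  have h1 : ∀ r : K, σ.toLinearMap (algebraMap K _ r) = algebraMap K _ r := fun r => by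
    rw [Algebra.algebraMap_eq_smul_one, map_smul, σ.map_one]
  have hsq : σ.toLinearMap x * σ.toLinearMap x = algebraMap K _ (pureSq x) := by
    have h := σ.map_mul_rev x x
    change σ.toLinearMap (x * x) = σ.toLinearMap x * σ.toLinearMap x at h
    rw [← h, mul_self_of_re_eq_zero hx, h1]
  by_contra hre
  set y := σ.toLinearMap x with hy
  have hz : ∀ {c : K}, y.re * c + c * y.re = 0 → c = 0 := by
    intro c hc
    have : 2 * y.re * c = 0 := by linear_combination hc
    simpa [h2, hre] using this
  have hI := congrArg QuaternionAlgebra.imI hsq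
  have hJ := congrArg QuaternionAlgebra.imJ hsq
  have hK := congrArg QuaternionAlgebra.imK hsq
  simp only [QuaternionAlgebra.imI_mul, QuaternionAlgebra.imJ_mul, QuaternionAlgebra.imK_mul,
    QuaternionAlgebra.algebraMap_eq] at hI hJ hK
  have hI' : y.imI = 0 := hz (by linear_combination hI)
  have hJ' : y.imJ = 0 := hz (by linear_combination hJ)
  have hK' : y.imK = 0 := hz (by linear_combination hK)
  have hyr : y = algebraMap K _ y.re := by
    ext <;> simp [QuaternionAlgebra.algebraMap_eq, hI', hJ', hK']
  have hxy : x = algebraMap K _ y.re := by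
    rw [← h1, ← hyr]
    exact (σ.invol x).symm
  rw [hxy] at hx
  simp [QuaternionAlgebra.algebraMap_eq, hre] at hx

theorem KInvolution.pureSq_apply {a b : K} (h2 : (2 : K) ≠ 0) (σ : KInvolution K ℍ[K,a,b])
    {x : ℍ[K,a,b]} (hx : x.re = 0) : pureSq (σ.toLinearMap x) = pureSq x := by
  have h := σ.map_mul_rev x x
  change σ.toLinearMap (x * x) = σ.toLinearMap x * σ.toLinearMap x at h
  rw [mul_self_of_re_eq_zero (σ.re_eq_zero h2 hx), mul_self_of_re_eq_zero hx,
    Algebra.algebraMap_eq_smul_one, map_smul, σ.map_one, Algebra.algebraMap_eq_smul_one] at h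
  have := congrArg QuaternionAlgebra.re h
  simpa using this.symm

/-- One of `x + σ x` and `x - σ x` is anisotropic if `x` is, by the parallelogram law. -/
theorem KInvolution.exists_eigenvector {a b : K} (h2 : (2 : K) ≠ 0) (σ : KInvolution K ℍ[K,a,b])
    {x : ℍ[K,a,b]} (hx : x.re = 0) (hx' : pureSq x ≠ 0) :
    ∃ t : ZMod 2, ∃ y, y = x + signChar K t • σ.toLinearMap x ∧ y.re = 0 ∧ pureSq y ≠ 0 ∧
      σ.toLinearMap y = signChar K t • y := by
  have hre := σ.re_eq_zero h2 hx
  have hinv : σ.toLinearMap (σ.toLinearMap x) = x := σ.invol x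
  have hpar : pureSq (x + σ.toLinearMap x) + pureSq (x - σ.toLinearMap x) = 4 * pureSq x := by
    have h := σ.pureSq_apply h2 hx
    simp only [pureSq, QuaternionAlgebra.imI_add, QuaternionAlgebra.imJ_add,
      QuaternionAlgebra.imK_add, QuaternionAlgebra.imI_sub, QuaternionAlgebra.imJ_sub,
      QuaternionAlgebra.imK_sub] at h ⊢
    linear_combination 2 * h
  by_cases h : pureSq (x + σ.toLinearMap x) = 0
  · refine ⟨1, _, rfl, ?_, ?_, ?_⟩
    · simp [hx, hre]
    · rw [signChar_one, neg_one_smul, ← sub_eq_add_neg]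
      intro h'
      rw [h, h', add_zero] at hpar
      have : (2 : K) * 2 * pureSq x = 0 := by linear_combination -hpar
      simp [h2, hx'] at this
    · simp [hinv, add_comm]
  · refine ⟨0, _, rfl, ?_, ?_, ?_⟩
    · simp [hx, hre]
    · simpa using h
    · simp [hinv, add_comm]

/-- The three vectors tried here are the cross products of `x` with the coordinate vectors, up to
scalars; if they are all isotropic then so is `x`. -/
theorem exists_anticommuting {a b : K} (h2 : (2 : K) ≠ 0) (ha : a ≠ 0) (hb : b ≠ 0)
    {x : ℍ[K,a,b]} (hx : x.re = 0) (hx' : pureSq x ≠ 0) :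
    ∃ y : ℍ[K,a,b], y.re = 0 ∧ pureSq y ≠ 0 ∧ x * y = -(y * x) := by
  by_contra! hcon
  have h₁ : pureSq (⟨0, b * x.imJ, -(a * x.imI), 0⟩ : ℍ[K,a,b]) = 0 := by
    by_contra h
    refine hcon _ rfl h ?_
    ext <;> simp [hx] <;> ring
  have h₂ : pureSq (⟨0, b * x.imK, 0, x.imI⟩ : ℍ[K,a,b]) = 0 := by
    by_contra h
    refine hcon _ rfl h ?_
    ext <;> simp [hx] <;> ring
  have h₃ : pureSq (⟨0, 0, a * x.imK, x.imJ⟩ : ℍ[K,a,b]) = 0 := by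
    by_contra h
    refine hcon _ rfl h ?_
    ext <;> simp [hx] <;> ring
  simp only [pureSq] at h₁ h₂ h₃ hx'
  have e₁ : b * x.imJ ^ 2 + a * x.imI ^ 2 = 0 := by
    have : a * b * (b * x.imJ ^ 2 + a * x.imI ^ 2) = 0 := by linear_combination h₁
    simpa [ha, hb] using this
  have e₂ : b * x.imK ^ 2 - x.imI ^ 2 = 0 := by
    have : a * b * (b * x.imK ^ 2 - x.imI ^ 2) = 0 := by linear_combination h₂
    simpa [ha, hb] using this
  have e₃ : a * x.imK ^ 2 - x.imJ ^ 2 = 0 := by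
    have : a * b * (a * x.imK ^ 2 - x.imJ ^ 2) = 0 := by linear_combination h₃
    simpa [ha, hb] using this
  have e₄ : x.imK ^ 2 = 0 := by
    have : 2 * a * b * x.imK ^ 2 = 0 := by linear_combination e₁ + a * e₂ + b * e₃
    simpa [ha, hb, h2] using this
  exact hx' (by linear_combination e₁ - a * b * e₄)

/-- Every involution of the first kind on a quaternion algebra is diagonal in some quaternion
basis. -/
theorem exists_diagonal_generators {a b : K} (h2 : (2 : K) ≠ 0) (ha : a ≠ 0) (hb : b ≠ 0)
    (σ : KInvolution K ℍ[K,a,b]) :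
    ∃ (x y : ℍ[K,a,b]) (c d : K) (s t : ZMod 2), c ≠ 0 ∧ d ≠ 0 ∧ x * x = algebraMap K _ c ∧
      y * y = algebraMap K _ d ∧ x * y = -(y * x) ∧ σ.toLinearMap x = signChar K s • x ∧
      σ.toLinearMap y = signChar K t • y := by
  obtain ⟨s, x, -, hx, hx', hσx⟩ := σ.exists_eigenvector h2 (x := ⟨0, 1, 0, 0⟩) rfl
    (by simpa [pureSq] using ha)
  obtain ⟨z, hz, hz', hxz⟩ := exists_anticommuting h2 ha hb hx hx'
  obtain ⟨t, y, hyz, hy, hy', hσy⟩ := σ.exists_eigenvector h2 hz hz'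
  refine ⟨x, y, _, _, s, t, hx', hy', mul_self_of_re_eq_zero hx, mul_self_of_re_eq_zero hy, ?_,
    hσx, hσy⟩
  have h : σ.toLinearMap z * (signChar K s • x) = -((signChar K s • x) * σ.toLinearMap z) := by
    have h₁ : σ.toLinearMap (x * z) = σ.toLinearMap z * σ.toLinearMap x := σ.map_mul_rev x z
    have h₂ : σ.toLinearMap (z * x) = σ.toLinearMap x * σ.toLinearMap z := σ.map_mul_rev z x
    rw [← hσx, ← h₁, ← h₂, hxz, map_neg]
  have h' : σ.toLinearMap z * x = -(x * σ.toLinearMap z) := by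
    rw [mul_smul_comm, smul_mul_assoc, ← smul_neg] at h
    exact smul_right_injective _ (signChar_ne_zero s) h
  rw [hyz, mul_add, add_mul, hxz, mul_smul_comm, smul_mul_assoc, h', smul_neg, neg_add, neg_neg]

/-- The parameter `t` records the type of `σ`: it is `0` if `σ` is orthogonal and `1` if `σ` is
symplectic. -/
theorem exists_isPauliBasis_factor {B : Type*} [Ring B] [Algebra K B] (h2 : (2 : K) ≠ 0)
    (hB : IsQuaternionAlgebra K B) (σ : KInvolution K B) :
    ∃ (t : ZMod 2) (e : Module.Basis (ZMod 2 × ZMod 2) K B),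
      IsPauliBasis planeForm (planeQuad t) σ e := by
  obtain ⟨a, b, ha, hb, ⟨φ⟩⟩ := hB
  have : Nontrivial B := φ.toEquiv.nontrivial
  have hdim : Module.finrank K B = 4 := by
    rw [φ.toLinearEquiv.finrank_eq, QuaternionAlgebra.finrank_eq_four]
  let τ : KInvolution K ℍ[K,a,b] :=
    { toLinearMap := φ.toLinearMap ∘ₗ σ.toLinearMap ∘ₗ φ.symm.toLinearMap
      map_mul_rev := fun x y => by
        have h := σ.map_mul_rev (φ.symm x) (φ.symm y)
        change φ (σ.toFun (φ.symm (x * y))) = φ (σ.toFun (φ.symm y)) * φ (σ.toFun (φ.symm x))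
        rw [map_mul, h, map_mul]
      invol := fun x => by
        change φ (σ.toFun (φ.symm (φ (σ.toFun (φ.symm x))))) = x
        rw [φ.symm_apply_apply, σ.invol, φ.apply_symm_apply] }
  have hτ : ∀ {x s}, τ.toLinearMap x = signChar K s • x →
      σ.toLinearMap (φ.symm x) = signChar K s • φ.symm x := by
    intro x s h
    change φ (σ.toLinearMap (φ.symm x)) = _ at h
    rw [← map_smul, ← h, φ.symm_apply_apply]
  obtain ⟨x', y', c, d, s, t, hc, hd, hx, hy, hxy, hσx, hσy⟩ :=
    exists_diagonal_generators h2 ha hb τ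
  replace hσx := hτ hσx
  replace hσy := hτ hσy
  replace hx := congrArg φ.symm hx
  replace hy := congrArg φ.symm hy
  replace hxy := congrArg φ.symm hxy
  simp only [map_mul, map_neg, AlgEquiv.commutes] at hx hy hxy
  generalize φ.symm x' = x at *
  generalize φ.symm y' = y at *
  by_cases hst : s = t
  · subst hst
    exact ⟨s, exists_isPauliBasis_of_generators h2 σ hdim hc hd hx hy hxy s hσx hσy⟩
  -- If the signs differ, `x * y` is symmetric and replaces the skew-symmetric generator.
  have hyx : y * x = -(x * y) := by rw [hxy, neg_neg]
  have hσxy : σ.toLinearMap (x * y) = signChar K 0 • (x * y) := by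
    have h := σ.map_mul_rev x y
    change σ.toLinearMap (x * y) = σ.toLinearMap y * σ.toLinearMap x at h
    have hst' : t + s = 1 := by
      rcases ZMod.eq_zero_or_eq_one s with rfl | rfl <;>
        rcases ZMod.eq_zero_or_eq_one t with rfl | rfl <;> simp_all
    rw [h, hσx, hσy, smul_mul_smul_comm, hyx, ← signChar_add, hst']
    simp
  have hsq : (x * y) * (x * y) = algebraMap K B (-(c * d)) := by
    have : (x * y) * (x * y) = -((x * x) * (y * y)) := by
      rw [mul_assoc, ← mul_assoc y, hyx, neg_mul, mul_neg]
      simp only [mul_assoc]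
    rw [this, hx, hy, map_neg, map_mul]
  have hcd : -(c * d) ≠ 0 := neg_ne_zero.mpr (mul_ne_zero hc hd)
  rcases ZMod.eq_zero_or_eq_one s with rfl | rfl
  · refine ⟨0, exists_isPauliBasis_of_generators h2 σ hdim hc hcd hx hsq ?_ 0 hσx hσxy⟩
    rw [mul_assoc, hyx, mul_neg, neg_neg]
  · have ht : t = 0 := (ZMod.eq_zero_or_eq_one t).resolve_right fun h => hst h.symm
    subst ht
    refine ⟨0, exists_isPauliBasis_of_generators h2 σ hdim hd hcd hy hsq ?_ 0 hσy hσxy⟩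
    rw [← mul_assoc, hyx, neg_mul]

end Quaternion

/-! ### Tensor products of Pauli bases -/

section Tensor

variable {K ι : Type*} [Field K] [Fintype ι]

/-- The orthogonal sum of copies of `planeForm`. -/
def sumForm : LinearMap.BilinForm (ZMod 2) (ι → ZMod 2 × ZMod 2) :=
  LinearMap.mk₂ (ZMod 2) (fun v w => ∑ k, planeForm (v k) (w k))
    (fun v v' w => by
      rw [← Finset.sum_add_distrib]
      exact Finset.sum_congr rfl fun k _ => by simp [planeForm]; ring)
    (fun c v w => by
      rw [smul_eq_mul, Finset.mul_sum]
      exact Finset.sum_congr rfl fun k _ => by simp [planeForm]; ring)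
    (fun v w w' => by
      rw [← Finset.sum_add_distrib]
      exact Finset.sum_congr rfl fun k _ => by simp [planeForm]; ring)
    (fun c v w => by
      rw [smul_eq_mul, Finset.mul_sum]
      exact Finset.sum_congr rfl fun k _ => by simp [planeForm]; ring)

theorem sumForm_apply (v w : ι → ZMod 2 × ZMod 2) :
    sumForm v w = ∑ k, planeForm (v k) (w k) := rfl

/-- The orthogonal sum of the forms `planeQuad (t k)`. -/
def sumQuad (t : ι → ZMod 2) (v : ι → ZMod 2 × ZMod 2) : ZMod 2 := ∑ k, planeQuad (t k) (v k)

theorem IsPauliBasis.piTensor {A : ι → Type*} [∀ k, Ring (A k)] [∀ k, Algebra K (A k)]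
    {σ : ∀ k, KInvolution K (A k)} {t : ι → ZMod 2}
    {e : ∀ k, Module.Basis (ZMod 2 × ZMod 2) K (A k)}
    (he : ∀ k, IsPauliBasis planeForm (planeQuad (t k)) (σ k) (e k)) :
    IsPauliBasis (fun v w => sumForm v w) (sumQuad t) (KInvolution.piTensor σ)
      (Basis.piTensorProduct e) where
  map_zero := by
    rw [Basis.piTensorProduct_apply, PiTensorProduct.one_def]
    congr 1
    funext k
    exact (he k).map_zero
  mul v w := by
    choose c hc hc' using fun k => (he k).mul (v k) (w k)
    refine ⟨∏ k, c k, Finset.prod_ne_zero_iff.mpr fun k _ => hc k, ?_⟩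
    simp only [Basis.piTensorProduct_apply, PiTensorProduct.tprod_mul_tprod]
    rw [← MultilinearMap.map_smul_univ]
    congr 1
    funext k
    exact hc' k
  comm v w := by
    simp only [Basis.piTensorProduct_apply, PiTensorProduct.tprod_mul_tprod]
    rw [sumForm_apply, signChar_sum, ← MultilinearMap.map_smul_univ]
    congr 1
    funext k
    exact (he k).comm (v k) (w k)
  map_involution v := by
    simp only [Basis.piTensorProduct_apply]
    change PiTensorProduct.map (fun i => (σ i).toLinearMap) _ = _
    rw [PiTensorProduct.map_tprod, sumQuad, signChar_sum, ← MultilinearMap.map_smul_univ]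
    congr 1
    funext k
    exact (he k).map_involution (v k)

end Tensor

/-! ### The trace of an involution -/

section Trace

theorem LinearMap.trace_of_basis_smul {K M V : Type*} [Field K] [AddCommGroup M] [Module K M]
    [Fintype V] (e : Module.Basis V K M) (f : M →ₗ[K] M) (c : V → K)
    (hf : ∀ v, f (e v) = c v • e v) : LinearMap.trace K M f = ∑ v, c v := by
  classical
  rw [LinearMap.trace_eq_matrix_trace K e, Matrix.trace]
  refine Finset.sum_congr rfl fun v _ => ?_
  simp [LinearMap.toMatrix_apply, hf]

theorem sum_signChar_planeQuad {K : Type*} [Field K] (t : ZMod 2) :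
    ∑ p, signChar K (planeQuad t p) = 2 * signChar K t := by
  rw [Fintype.sum_prod_type]
  have huniv : (Finset.univ : Finset (ZMod 2)) = {0, 1} := rfl
  have h11 : (1 + 1 : ZMod 2) = 0 := rfl
  simp only [huniv, Finset.sum_pair (zero_ne_one (α := ZMod 2)), planeQuad]
  rcases ZMod.eq_zero_or_eq_one t with rfl | rfl
  · simp; norm_num
  · simp [h11]; norm_num

/-- The trace of the involution determines the sum of the types of the factors, that is, the Arf
invariant of `sumQuad t`. -/
theorem IsPauliBasis.trace_involution {K A ι : Type*} [Field K] [Fintype ι] [Ring A] [Algebra K A]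
    {σ : KInvolution K A} {t : ι → ZMod 2}
    {ω : (ι → ZMod 2 × ZMod 2) → (ι → ZMod 2 × ZMod 2) → ZMod 2}
    {e : Module.Basis (ι → ZMod 2 × ZMod 2) K A} (he : IsPauliBasis ω (sumQuad t) σ e) :
    LinearMap.trace K A σ.toLinearMap = 2 ^ Fintype.card ι * signChar K (∑ k, t k) := by
  classical
  rw [LinearMap.trace_of_basis_smul e _ _ he.map_involution]
  simp only [sumQuad, signChar_sum]
  rw [← Fintype.piFinset_univ, ← Finset.prod_univ_sum (fun _ => Finset.univ) fun k p =>
    signChar K (planeQuad (t k) p)]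
  simp only [sum_signChar_planeQuad, Finset.prod_mul_distrib, Finset.prod_const, Finset.card_univ]

/-- If `Bᵀ = c B`, then the operator sending a matrix to its adjoint with respect to `B` has trace
`c` times the size of `B`. -/
theorem Matrix.trace_adjoint {L m : Type*} [Field L] [Fintype m] [DecidableEq m]
    (B : Matrix m m L) (hB : IsUnit B.det) (c : L) (hc : B.transpose = c • B)
    (f : Matrix m m L →ₗ[L] Matrix m m L) (hf : ∀ M, (f M).transpose * B = B * M) :
    LinearMap.trace L _ f = c * Fintype.card m := by
  rw [LinearMap.trace_eq_matrix_trace L (Matrix.stdBasis L m m), Matrix.trace]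
  have hdiag : ∀ i j, (LinearMap.toMatrix (Matrix.stdBasis L m m) (Matrix.stdBasis L m m) f).diag
      (i, j) = c * (B i j * B⁻¹ j i) := by
    intro i j
    have h : f (Matrix.single i j 1) = (B * Matrix.single i j 1 * B⁻¹).transpose := by
      rw [← hf, Matrix.mul_nonsing_inv_cancel_right _ _ hB, Matrix.transpose_transpose]
    have hji : B j i = c * B i j := congrFun (congrFun hc i) j
    have : (B * Matrix.single i j 1 * B⁻¹ : Matrix m m L) j i = B j i * B⁻¹ j i := by
      rw [Matrix.mul_apply, Finset.sum_eq_single j]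
      · simp
      · intro k _ hk
        simp [Matrix.mul_single_apply_of_ne, hk]
      · simp
    simp only [Matrix.diag_apply, LinearMap.toMatrix_apply, Matrix.stdBasis_eq_single, h]
    change (B * Matrix.single i j 1 * B⁻¹ : Matrix m m L) j i = _
    rw [this, hji, mul_assoc]
  rw [Fintype.sum_prod_type]
  simp only [hdiag, ← Finset.mul_sum]
  congr 1
  have h1 : ∀ i, ∑ j, B i j * B⁻¹ j i = 1 := fun i => by
    rw [← Matrix.mul_apply, Matrix.mul_nonsing_inv _ hB, Matrix.one_apply_eq]
  simp [h1]

/-- The trace of an involution that becomes adjoint to an `ε`-symmetric form. -/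
theorem KInvolution.IsAdjointVia.trace {K A L V : Type*} [Field K] [Ring A] [Algebra K A]
    [Module.Finite K A] [Field L] [Algebra K L] [AddCommGroup V] [Module L V] [Module.Finite L V]
    {σ : KInvolution K A} {φ : L ⊗[K] A ≃ₐ[L] Module.End L V} {b : LinearMap.BilinForm L V}
    (hb : b.Nondegenerate)
    (h : σ.IsAdjointVia φ b) (c : L) (hc : ∀ x y, b y x = c * b x y) :
    algebraMap K L (LinearMap.trace K A σ.toLinearMap) = c * Module.finrank L V := by
  classical
  let β := Module.finBasis L V
  let ψ : L ⊗[K] A ≃ₗ[L] Matrix _ _ L := φ.toLinearEquiv.trans (LinearMap.toMatrix β β)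
  let B := LinearMap.BilinForm.toMatrix β b
  have hB : IsUnit B.det :=
    isUnit_iff_ne_zero.mpr ((LinearMap.BilinForm.nondegenerate_iff_det_ne_zero β).mp hb)
  have hBij : ∀ i j, B i j = b (β i) (β j) := fun i j => LinearMap.BilinForm.toMatrix_apply _ _ _ _
  rw [← LinearMap.trace_baseChange, ← LinearMap.trace_conj' _ ψ,
    Matrix.trace_adjoint B hB c _ _ _, Fintype.card_fin]
  · ext i j
    rw [Matrix.transpose_apply, Matrix.smul_apply, hBij, hBij, hc, smul_eq_mul]
  · intro M
    obtain ⟨a, rfl⟩ := ψ.surjective M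
    rw [LinearEquiv.conj_apply_apply, ψ.symm_apply_apply]
    have hψ : ∀ a i j, ψ a i j = β.repr (φ a (β j)) i := fun a i j =>
      LinearMap.toMatrix_apply _ _ _ _ _
    have hβ : ∀ a j, φ a (β j) = ∑ k, ψ a k j • β k := fun a j => by
      simp only [hψ]
      exact (β.sum_repr _).symm
    ext i j
    rw [Matrix.mul_apply, Matrix.mul_apply]
    have hij := h a (β i) (β j)
    rw [hβ, hβ, map_sum, map_sum, LinearMap.sum_apply] at hij
    simp only [map_smul, LinearMap.smul_apply, smul_eq_mul, ← hBij] at hij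
    simp only [Matrix.transpose_apply]
    rw [← hij]
    exact Finset.sum_congr rfl fun k _ => mul_comm _ _

/-- Comparison of the trace of the involution, computed from a Pauli basis, with the trace of the
adjoint involution of an `ε`-symmetric form over a splitting field. -/
theorem IsPauliBasis.signChar_sum_eq {K A L V ι : Type*} [Field K] [Ring A] [Algebra K A]
    [Fintype ι] {σ : KInvolution K A} {t : ι → ZMod 2}
    {ω : (ι → ZMod 2 × ZMod 2) → (ι → ZMod 2 × ZMod 2) → ZMod 2}
    {e : Module.Basis (ι → ZMod 2 × ZMod 2) K A} (he : IsPauliBasis ω (sumQuad t) σ e)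
    (h2 : (2 : K) ≠ 0) [Field L] [Algebra K L] [AddCommGroup V] [Module L V] [Module.Finite L V]
    {φ : L ⊗[K] A ≃ₐ[L] Module.End L V} {b : LinearMap.BilinForm L V}
    (hb : b.Nondegenerate)
    (h : σ.IsAdjointVia φ b) (s : ZMod 2) (hs : ∀ x y, b y x = signChar L s * b x y) :
    ∑ k, t k = s := by
  classical
  have : Module.Finite K A := .of_basis e
  have h2' : (2 : L) ≠ 0 := by
    rw [← map_ofNat (algebraMap K L) 2]
    exact (map_ne_zero _).mpr h2
  have hA : Module.finrank K A = (2 ^ Fintype.card ι) ^ 2 := by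
    rw [Module.finrank_eq_card_basis e, Fintype.card_fun, Fintype.card_prod, ZMod.card, mul_pow, sq]
  have hV : Module.finrank L V = 2 ^ Fintype.card ι := by
    have h₁ := φ.toLinearEquiv.finrank_eq
    rw [Module.finrank_baseChange, hA, Module.finrank_linearMap, ← sq] at h₁
    exact (Nat.pow_left_injective two_ne_zero h₁).symm
  have htr := h.trace hb (signChar L s) hs
  have hmap : ∀ a, algebraMap K L (signChar K a) = signChar L a := fun a => by
    rcases ZMod.eq_zero_or_eq_one a with rfl | rfl <;> simp
  rw [he.trace_involution, map_mul, hmap, map_pow, map_ofNat, hV, Nat.cast_pow, Nat.cast_ofNat,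
    mul_comm] at htr
  exact signChar_injective h2' (mul_right_cancel₀ (pow_ne_zero _ h2') htr)

end Trace

/-! ### Clifford algebras from Pauli bases -/

section Clifford

theorem CliffordAlgebra.finrank_eq {K V : Type*} [Field K] (h2 : (2 : K) ≠ 0) [AddCommGroup V]
    [Module K V] [Module.Finite K V] (q : QuadraticForm K V) :
    Module.finrank K (CliffordAlgebra q) = 2 ^ Module.finrank K V := by
  have : Invertible (2 : K) := invertibleOfNonzero h2
  rw [(CliffordAlgebra.equivExterior q).finrank_eq,
    Module.finrank_eq_card_basis (Module.finBasis K V).ExteriorAlgebra, Fintype.card_finset,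
    Fintype.card_fin]

theorem CliffordAlgebra.finite {K V : Type*} [Field K] (h2 : (2 : K) ≠ 0) [AddCommGroup V]
    [Module K V] [Module.Finite K V] (q : QuadraticForm K V) :
    Module.Finite K (CliffordAlgebra q) := by
  have : Invertible (2 : K) := invertibleOfNonzero h2
  have : Module.Finite K (ExteriorAlgebra K V) := .of_basis (Module.finBasis K V).ExteriorAlgebra
  exact Module.Finite.equiv (CliffordAlgebra.equivExterior q).symm

theorem nondegenerate_polarBilin_weightedSumSquares {K ι : Type*} [Field K] (h2 : (2 : K) ≠ 0)
    [Fintype ι] {w : ι → K} (hw : ∀ a, w a ≠ 0) :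
    (QuadraticMap.polarBilin (QuadraticMap.weightedSumSquares K w)).Nondegenerate := by
  classical
  have hpolar : ∀ x a, QuadraticMap.polarBilin (QuadraticMap.weightedSumSquares K w) x
      (Pi.single a 1) = 2 * w a * x a := by
    intro x a
    rw [QuadraticMap.polarBilin_apply_apply, QuadraticMap.polar]
    simp only [QuadraticMap.weightedSumSquares_apply, ← Finset.sum_sub_distrib]
    rw [Finset.sum_eq_single a]
    · simp; ring
    · intro b _ hb
      simp [hb]
    · simp
  have hl : LinearMap.SeparatingLeft
      (QuadraticMap.polarBilin (QuadraticMap.weightedSumSquares K w)) := by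
    intro x hx
    funext a
    have h := hx (Pi.single a 1)
    rw [hpolar] at h
    simpa [h2, hw a] using h
  refine ⟨hl, fun x hx => hl x fun y => ?_⟩
  rw [← hx y, QuadraticMap.polarBilin_apply_apply, QuadraticMap.polarBilin_apply_apply,
    QuadraticMap.polar_comm]

/-- Pairwise anticommuting elements with scalar squares give a representation of the Clifford
algebra of a diagonal form. -/
theorem sum_smul_mul_self {K A ι : Type*} [Field K] [Ring A] [Algebra K A] [Fintype ι]
    (h2 : (2 : K) ≠ 0) {w : ι → K} {g : ι → A} (hsq : ∀ a, g a * g a = algebraMap K A (w a))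
    (hanti : ∀ a b, a ≠ b → g a * g b = -(g b * g a)) (x : ι → K) :
    (∑ a, x a • g a) * (∑ a, x a • g a) =
      algebraMap K A (QuadraticMap.weightedSumSquares K w x) := by
  classical
  -- Twice the square is a double sum of anticommutators, of which only the diagonal survives.
  have h : (2 : K) • ((∑ a, x a • g a) * (∑ a, x a • g a)) =
      (2 : K) • algebraMap K A (QuadraticMap.weightedSumSquares K w x) := by
    have hexp : (∑ a, x a • g a) * (∑ a, x a • g a) =
        ∑ a, ∑ b, (x a * x b) • (g a * g b) := by
      rw [Finset.sum_mul_sum]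
      simp only [smul_mul_smul_comm]
    have hexp' : (∑ a, x a • g a) * (∑ a, x a • g a) =
        ∑ a, ∑ b, (x a * x b) • (g b * g a) := by
      rw [hexp, Finset.sum_comm]
      simp only [mul_comm]
    rw [two_smul]
    nth_rewrite 1 [hexp]
    rw [hexp', ← Finset.sum_add_distrib, QuadraticMap.weightedSumSquares_apply, map_sum,
      Finset.smul_sum]
    refine Finset.sum_congr rfl fun a _ => ?_
    rw [← Finset.sum_add_distrib, Finset.sum_eq_single a]
    · rw [← two_smul K, hsq, smul_eq_mul, mul_comm (w a), map_mul _ (x a * x a),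
        Algebra.smul_def (x a * x a)]
    · intro b _ hb
      rw [hanti a b hb.symm, smul_neg, neg_add_cancel]
    · simp
  exact smul_right_injective _ h2 h

/-- Vectors pairing to `1` with each other under an alternating form are linearly independent if
there is an even number of them. -/
theorem linearIndependent_of_form_eq_one {V ι : Type*} [AddCommGroup V] [Module (ZMod 2) V]
    [Fintype ι] (hι : Even (Fintype.card ι)) (ω : LinearMap.BilinForm (ZMod 2) V)
    (hω : ω.IsAlt) {v : ι → V} (hv : ∀ a b, a ≠ b → ω (v a) (v b) = 1) :
    LinearIndependent (ZMod 2) v := by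
  classical
  rw [Fintype.linearIndependent_iff]
  intro g hg
  have hcoef : ∀ b, g b = ∑ a, g a := by
    intro b
    have h : ∑ a, g a * ω (v a) (v b) = 0 := by
      have := congrArg (fun x => ω x (v b)) hg
      simpa using this
    have h' : ∑ a, g a * ω (v a) (v b) = ∑ a, g a - g b := by
      rw [← Finset.add_sum_erase _ _ (Finset.mem_univ b), ← Finset.add_sum_erase _ g
        (Finset.mem_univ b), hω, mul_zero, zero_add, add_sub_cancel_left]
      refine Finset.sum_congr rfl fun a ha => ?_
      rw [hv a b (Finset.ne_of_mem_erase ha), mul_one]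
    rw [h'] at h
    exact (sub_eq_zero.mp h).symm
  have hs : ∑ a, g a = 0 := by
    rw [Finset.sum_congr rfl fun a _ => hcoef a, Finset.sum_const, Finset.card_univ, nsmul_eq_mul,
      (ZMod.natCast_eq_zero_iff_even).mpr hι, zero_mul]
  intro b
  rw [hcoef, hs]

/-- Vectors `v a` of an even-dimensional symplectic space over `𝔽₂` that pairwise pair to `1`, as
many as the dimension, index generators of `A` that satisfy the relations of a Clifford algebra. -/
theorem IsPauliBasis.exists_cliffordEquiv {K A V ι : Type*} [Field K] [Ring A] [Algebra K A]
    [AddCommGroup V] [Module (ZMod 2) V] [Fintype V] [Fintype ι]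
    {ω : LinearMap.BilinForm (ZMod 2) V} {Q : V → ZMod 2} {σ : KInvolution K A}
    {e : Module.Basis V K A} (he : IsPauliBasis (fun v w => ω v w) Q σ e) (h2 : (2 : K) ≠ 0)
    (hω : ω.IsAlt) (hι : Even (Fintype.card ι))
    (hdim : Fintype.card ι = Module.finrank (ZMod 2) V) {v : ι → V}
    (hv : ∀ a b, a ≠ b → ω (v a) (v b) = 1) :
    ∃ (w : ι → K) (f : CliffordAlgebra (QuadraticMap.weightedSumSquares K w) ≃ₐ[K] A),
      (∀ a, w a ≠ 0) ∧ ∀ x, f (CliffordAlgebra.ι _ x) = ∑ a, x a • e (v a) := by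
  classical
  have hVV : ∀ u : V, u + u = 0 := fun u => by
    rw [← two_smul (ZMod 2) u]
    exact zero_smul _ _
  choose w hw hsq using fun a => he.mul (v a) (v a)
  replace hsq : ∀ a, e (v a) * e (v a) = algebraMap K A (w a) := fun a => by
    rw [hsq, hVV, he.map_zero, Algebra.algebraMap_eq_smul_one]
  have hanti : ∀ a b, a ≠ b → e (v a) * e (v b) = -(e (v b) * e (v a)) := fun a b hab => by
    rw [he.comm, hv a b hab, signChar_one, neg_one_smul]
  let L : (ι → K) →ₗ[K] A := Fintype.linearCombination K fun a => e (v a)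
  have hL : ∀ x, L x = ∑ a, x a • e (v a) := fun x => Fintype.linearCombination_apply _ _ _
  let F : CliffordAlgebra (QuadraticMap.weightedSumSquares K w) →ₐ[K] A :=
    CliffordAlgebra.lift _ ⟨L, fun x => by rw [hL]; exact sum_smul_mul_self h2 hsq hanti x⟩
  have hF : ∀ x, F (CliffordAlgebra.ι _ x) = ∑ a, x a • e (v a) := fun x => by
    rw [← hL]
    exact CliffordAlgebra.lift_ι_apply _ _ _
  -- The indices of basis vectors in the range of `F` form a subgroup containing a basis.
  let S : AddSubmonoid V :=
    { carrier := {u | e u ∈ F.range}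
      zero_mem' := by
        change e 0 ∈ F.range
        rw [he.map_zero]
        exact one_mem _
      add_mem' := by
        intro u u' hu hu'
        obtain ⟨c, hc, h⟩ := he.mul u u'
        change e (u + u') ∈ F.range
        rw [← inv_smul_smul₀ hc (e (u + u')), ← h]
        exact Subalgebra.smul_mem _ (mul_mem hu hu') _ }
  have hS : ∀ u, u ∈ S := by
    have hspan : Submodule.span (ZMod 2) (Set.range v) = ⊤ :=
      (linearIndependent_of_form_eq_one hι ω hω hv).span_eq_top_of_card_eq_finrank' hdim
    intro u
    have hu : u ∈ Submodule.span (ZMod 2) (Set.range v) := hspan ▸ Submodule.mem_top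
    induction hu using Submodule.span_induction with
    | mem u hu =>
      obtain ⟨a, rfl⟩ := hu
      refine ⟨CliffordAlgebra.ι _ (Pi.single a 1), ?_⟩
      change F _ = _
      rw [hF, Finset.sum_eq_single a]
      · simp
      · intro b _ hb
        simp [hb]
      · simp
    | zero => exact S.zero_mem
    | add u u' _ _ hu hu' => exact S.add_mem hu hu'
    | smul c u _ hu =>
      rcases ZMod.eq_zero_or_eq_one c with rfl | rfl
      · rw [zero_smul]
        exact S.zero_mem
      · rwa [one_smul]
  have hsurj : Function.Surjective F := by
    intro y
    change y ∈ F.range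
    rw [← e.sum_repr y]
    exact sum_mem fun u _ => Subalgebra.smul_mem _ (hS u) _
  have hfin := CliffordAlgebra.finite h2 (QuadraticMap.weightedSumSquares K w)
  have : Module.Finite K A := .of_basis e
  have hcard : Module.finrank K (CliffordAlgebra (QuadraticMap.weightedSumSquares K w)) =
      Module.finrank K A := by
    rw [CliffordAlgebra.finrank_eq h2, Module.finrank_fintype_fun_eq_card,
      Module.finrank_eq_card_basis e, hdim, Module.card_eq_pow_finrank (K := ZMod 2) (V := V),
      ZMod.card]
  have hinj : Function.Injective F :=
    (LinearMap.injective_iff_surjective_of_finrank_eq_finrank (f := F.toLinearMap) hcard).mpr hsurj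
  exact ⟨w, AlgEquiv.ofBijective F ⟨hinj, hsurj⟩, hw, hF⟩

/-- It suffices to compare the involutions on the generators of the Clifford algebra. -/
theorem KInvolution.isomorphic_cliffordInvolution {K A V : Type*} [Field K] [Ring A] [Algebra K A]
    [AddCommGroup V] [Module K V] {q : QuadraticForm K V} {σ : KInvolution K A}
    (s : OrthogonalSymmetry q) (f : CliffordAlgebra q ≃ₐ[K] A)
    (hf : ∀ x, f (CliffordAlgebra.ι q (s.toLinearMap x)) =
      σ.toLinearMap (f (CliffordAlgebra.ι q x))) :
    σ.Isomorphic s.cliffordInvolution := by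
  have key : ∀ z, f (s.cliffordInvolution.toLinearMap z) = σ.toLinearMap (f z) := by
    have hσ : ∀ x y, σ.toLinearMap (x * y) = σ.toLinearMap y * σ.toLinearMap x := σ.map_mul_rev
    have hs : ∀ x y, s.cliffordInvolution.toLinearMap (x * y) =
        s.cliffordInvolution.toLinearMap y * s.cliffordInvolution.toLinearMap x :=
      s.cliffordInvolution.map_mul_rev
    intro z
    induction z using CliffordAlgebra.induction with
    | algebraMap r =>
      simp only [Algebra.algebraMap_eq_smul_one, map_smul, KInvolution.map_one, _root_.map_one]
    | ι x => rw [s.cliffordInvolution_ι, hf]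
    | mul a b ha hb => rw [hs, map_mul, map_mul, hσ, ha, hb]
    | add a b ha hb => rw [map_add, map_add, map_add, map_add, ha, hb]
  refine ⟨f.symm, fun x => ?_⟩
  rw [AlgEquiv.symm_apply_eq, key, f.apply_symm_apply]

end Clifford

/-! ### The involutions of a Clifford algebra of a diagonal form -/

section Recognition

variable {K : Type u} {A V ι : Type*} [Field K] [Ring A] [Algebra K A]
  [AddCommGroup V] [Module (ZMod 2) V] [Fintype ι]
  {ω : LinearMap.BilinForm (ZMod 2) V} {Q : V → ZMod 2} {σ : KInvolution K A}
  {e : Module.Basis V K A}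

theorem IsPauliBasis.map_involution_sum (he : IsPauliBasis (fun v w => ω v w) Q σ e) (v : ι → V)
    (x : ι → K) : σ.toLinearMap (∑ a, x a • e (v a)) =
      ∑ a, (signChar K (Q (v a)) * x a) • e (v a) := by
  simp only [map_sum, map_smul, he.map_involution, smul_smul, mul_comm]

/-- The symmetry of a diagonal quadratic form that changes the sign of one coordinate. -/
def coordinateReflection {ι : Type*} [Fintype ι] (w : ι → K) (a : ι) :
    OrthogonalSymmetry (QuadraticMap.weightedSumSquares K w) := by
  classical exact
  { toLinearMap := LinearMap.pi fun b =>
      signChar K (if b = a then 1 else 0) • LinearMap.proj b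
    map_app' := fun x => by
      simp only [QuadraticMap.weightedSumSquares_apply]
      refine Finset.sum_congr rfl fun b _ => ?_
      by_cases h : b = a <;> simp [h]
    invol := fun x => by
      funext b
      by_cases h : b = a <;> simp [h] }

theorem coordinateReflection_apply [DecidableEq ι] (w : ι → K) (a : ι) (x : ι → K) (b : ι) :
    (coordinateReflection w a).toLinearMap x b = signChar K (if b = a then 1 else 0) * x b := by
  simp only [coordinateReflection, LinearMap.pi_apply, LinearMap.smul_apply, LinearMap.proj_apply,
    smul_eq_mul]
  by_cases h : b = a <;> simp [h]

theorem coordinateReflection_isReflection (h2 : (2 : K) ≠ 0) (w : ι → K) (a : ι) :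
    (coordinateReflection w a).IsReflection := by
  classical
  have hfix : (coordinateReflection w a).fixedSubspace =
      LinearMap.ker (LinearMap.proj a : (ι → K) →ₗ[K] K) := by
    ext x
    rw [OrthogonalSymmetry.fixedSubspace, LinearMap.mem_eqLocus, LinearMap.mem_ker,
      LinearMap.id_apply, LinearMap.proj_apply]
    constructor
    · intro h
      have ha := congrFun h a
      rw [coordinateReflection_apply, if_pos rfl, signChar_one] at ha
      have : 2 * x a = 0 := by linear_combination -ha
      simpa [h2] using this
    · intro h
      funext b
      rw [coordinateReflection_apply]
      by_cases hb : b = a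
      · rw [hb, h, mul_zero]
      · rw [if_neg hb, signChar_zero, one_mul]
  have hrange : LinearMap.range (LinearMap.proj a : (ι → K) →ₗ[K] K) = ⊤ :=
    LinearMap.range_eq_top.mpr fun c => ⟨fun _ => c, rfl⟩
  have h := LinearMap.finrank_range_add_finrank_ker (LinearMap.proj a : (ι → K) →ₗ[K] K)
  rw [hrange, finrank_top, Module.finrank_self] at h
  rw [OrthogonalSymmetry.IsReflection, hfix, add_comm, h]

variable [Fintype V] {ι : Type} [Fintype ι]

theorem IsPauliBasis.isCliffordId (he : IsPauliBasis (fun v w => ω v w) Q σ e) (h2 : (2 : K) ≠ 0)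
    (hω : ω.IsAlt) (hι : Even (Fintype.card ι))
    (hdim : Fintype.card ι = Module.finrank (ZMod 2) V) {v : ι → V}
    (hv : ∀ a b, a ≠ b → ω (v a) (v b) = 1) (hQ : ∀ a, Q (v a) = 0) :
    IsCliffordId (Fintype.card ι) σ := by
  obtain ⟨w, f, hw, hf⟩ := he.exists_cliffordEquiv h2 hω hι hdim hv
  refine ⟨ι → K, _, _, QuadraticMap.weightedSumSquares K w, inferInstance,
    Module.finrank_fintype_fun_eq_card K, nondegenerate_polarBilin_weightedSumSquares h2 hw,
    KInvolution.isomorphic_cliffordInvolution _ f fun x => ?_⟩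
  rw [hf, hf, he.map_involution_sum]
  refine Finset.sum_congr rfl fun a _ => ?_
  rw [hQ, signChar_zero, one_mul]
  rfl

theorem IsPauliBasis.isCliffordNegId (he : IsPauliBasis (fun v w => ω v w) Q σ e)
    (h2 : (2 : K) ≠ 0) (hω : ω.IsAlt) (hι : Even (Fintype.card ι))
    (hdim : Fintype.card ι = Module.finrank (ZMod 2) V) {v : ι → V}
    (hv : ∀ a b, a ≠ b → ω (v a) (v b) = 1) (hQ : ∀ a, Q (v a) = 1) :
    IsCliffordNegId (Fintype.card ι) σ := by
  obtain ⟨w, f, hw, hf⟩ := he.exists_cliffordEquiv h2 hω hι hdim hv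
  refine ⟨ι → K, _, _, QuadraticMap.weightedSumSquares K w, inferInstance,
    Module.finrank_fintype_fun_eq_card K, nondegenerate_polarBilin_weightedSumSquares h2 hw,
    KInvolution.isomorphic_cliffordInvolution _ f fun x => ?_⟩
  rw [hf, hf, he.map_involution_sum]
  refine Finset.sum_congr rfl fun a _ => ?_
  rw [hQ, signChar_one, neg_one_mul]
  rfl

theorem IsPauliBasis.isCliffordReflection [DecidableEq ι]
    (he : IsPauliBasis (fun v w => ω v w) Q σ e)
    (h2 : (2 : K) ≠ 0) (hω : ω.IsAlt) (hι : Even (Fintype.card ι))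
    (hdim : Fintype.card ι = Module.finrank (ZMod 2) V) {v : ι → V}
    (hv : ∀ a b, a ≠ b → ω (v a) (v b) = 1) (a₀ : ι)
    (hQ : ∀ a, Q (v a) = if a = a₀ then 1 else 0) :
    IsCliffordReflection (Fintype.card ι) σ := by
  obtain ⟨w, f, hw, hf⟩ := he.exists_cliffordEquiv h2 hω hι hdim hv
  refine ⟨ι → K, _, _, QuadraticMap.weightedSumSquares K w, inferInstance,
    Module.finrank_fintype_fun_eq_card K, nondegenerate_polarBilin_weightedSumSquares h2 hw,
    coordinateReflection w a₀, coordinateReflection_isReflection h2 w a₀,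
    KInvolution.isomorphic_cliffordInvolution _ f fun x => ?_⟩
  rw [hf, hf, he.map_involution_sum]
  refine Finset.sum_congr rfl fun a _ => ?_
  rw [hQ, coordinateReflection_apply]

end Recognition

/-! ### Tournaments with prescribed out-degree parities -/

section Tournament

theorem sum_sum_lt (n : ℕ) :
    ∑ i : Fin n, ∑ j : Fin n, (if i < j then 1 else 0 : ZMod 2) = (n.choose 2 : ℕ) := by
  have h : ∀ i : Fin n, ∑ j : Fin n, (if i < j then 1 else 0 : ZMod 2) =
      ((n - 1 - i : ℕ) : ZMod 2) := by
    intro i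
    rw [Finset.sum_boole, Finset.filter_lt_eq_Ioi, Fin.card_Ioi]
  simp only [h]
  rw [← Nat.cast_sum, Fin.sum_univ_eq_sum_range (fun i => n - 1 - i), Finset.sum_range_reflect
    (fun i => i), Finset.sum_range_id, Nat.choose_two_right]

/-- The parities of the out-degrees of a tournament on `n` vertices can be prescribed, as long as
they sum to the parity of the number of edges. The transitive tournament is corrected by reversing
edges at one vertex. -/
theorem exists_tournament {n : ℕ} (hn : 0 < n) (d : Fin n → ZMod 2)
    (hd : ∑ i, d i = (n.choose 2 : ℕ)) :
    ∃ T : Fin n → Fin n → ZMod 2, (∀ i, T i i = 0) ∧ (∀ i j, i ≠ j → T i j + T j i = 1) ∧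
      ∀ i, ∑ j, T i j = d i := by
  let z : Fin n := ⟨0, hn⟩
  let r (i : Fin n) : ZMod 2 := ∑ j : Fin n, if i < j then 1 else 0
  let c (i : Fin n) : ZMod 2 := d i - r i
  have hc : ∑ i, c i = 0 := by
    rw [Finset.sum_sub_distrib, hd, sum_sum_lt, sub_self]
  -- `M` is symmetric with row sums `c`, so it records a reversal of edges at `z`.
  let M (i j : Fin n) : ZMod 2 :=
    if i = j then 0 else (if j = z then c i else 0) + (if i = z then c j else 0)
  have hM : ∀ i, ∑ j, M i j = c i := by
    intro i
    by_cases hi : i = z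
    · have h : ∀ j, M i j = c j - if j = z then c z else 0 := by
        intro j
        by_cases hj : j = z
        · simp [M, hi, hj]
        · simp [M, hi, hj, Ne.symm hj]
      simp only [h, Finset.sum_sub_distrib, hc]
      rw [Finset.sum_ite_eq' Finset.univ z, if_pos (Finset.mem_univ _), hi, zero_sub,
        ZMod.neg_eq_self_mod_two]
    · have h : ∀ j, M i j = if j = z then c i else 0 := by
        intro j
        by_cases hj : j = z
        · simp [M, hi, hj]
        · simp [M, hi, hj]
      simp only [h]
      rw [Finset.sum_ite_eq' Finset.univ z, if_pos (Finset.mem_univ _)]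
  refine ⟨fun i j => (if i < j then 1 else 0) + M i j, fun i => by simp [M], ?_, ?_⟩
  · intro i j hij
    have hMij : M i j + M j i = 0 := by
      have : M i j = M j i := by simp only [M, hij, hij.symm, if_false]; ring
      rw [this]
      exact CharTwo.add_self_eq_zero _
    have hlt : (if i < j then 1 else 0 : ZMod 2) + (if j < i then 1 else 0) = 1 := by
      rcases lt_or_gt_of_ne hij with h | h <;> simp [h, h.not_gt]
    linear_combination hMij + hlt
  · intro i
    rw [Finset.sum_add_distrib, hM]
    exact add_sub_cancel _ _

end Tournament

/-! ### Vectors attached to a tournament -/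

section Vectors

variable {ι : Type*} [Fintype ι]

theorem sumForm_isAlt : (sumForm (ι := ι)).IsAlt := fun v => by
  rw [sumForm_apply]
  refine Finset.sum_eq_zero fun k _ => ?_
  rw [planeForm, mul_comm (v k).2]
  exact CharTwo.add_self_eq_zero _

theorem sumForm_comm (v w : ι → ZMod 2 × ZMod 2) : sumForm v w = sumForm w v := by
  rw [sumForm_apply, sumForm_apply]
  exact Finset.sum_congr rfl fun k _ => by rw [planeForm, planeForm]; ring

theorem sumForm_diag (f g : ι → ZMod 2) : sumForm (fun k => (f k, f k)) (fun k => (g k, g k)) =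
    0 := by
  rw [sumForm_apply]
  exact Finset.sum_eq_zero fun k _ => CharTwo.add_self_eq_zero _

theorem sumQuad_one (t : ι → ZMod 2) : sumQuad t (fun _ => (1, 1)) = Fintype.card ι := by
  have h : ∀ a : ZMod 2, planeQuad a (1, 1) = 1 := by decide
  simp [sumQuad, h]

variable [DecidableEq ι]

theorem sumForm_single (m : ι) (p : ZMod 2 × ZMod 2) (w : ι → ZMod 2 × ZMod 2) :
    sumForm (Pi.single m p) w = planeForm p (w m) := by
  rw [sumForm_apply, Finset.sum_eq_single m]
  · rw [Pi.single_eq_same]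
  · intro k _ hk
    rw [Pi.single_eq_of_ne hk]
    simp [planeForm]
  · simp

theorem planeForm_diag {p : ZMod 2 × ZMod 2} (hp : p.1 + p.2 = 1) (c : ZMod 2) :
    planeForm p (c, c) = c := by
  rw [planeForm]
  linear_combination c * hp

/-- The vector with component `p` in the plane of index `m`, and component `(T m k, T m k)` in the
plane of index `k ≠ m`. -/
def tournamentVector (T : ι → ι → ZMod 2) (m : ι) (p : ZMod 2 × ZMod 2) :
    ι → ZMod 2 × ZMod 2 :=
  Pi.single m p + fun k => (T m k, T m k)

variable {T : ι → ι → ZMod 2}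

theorem sumForm_tournamentVector (m m' : ι) {p p' : ZMod 2 × ZMod 2} (hp : p.1 + p.2 = 1)
    (hp' : p'.1 + p'.2 = 1) :
    sumForm (tournamentVector T m p) (tournamentVector T m' p') =
      (if m = m' then planeForm p p' else 0) + (T m m' + T m' m) := by
  rw [tournamentVector, tournamentVector, LinearMap.map_add₂, map_add, map_add, sumForm_diag,
    sumForm_single, sumForm_single, sumForm_comm _ (Pi.single m' p'), sumForm_single,
    planeForm_diag hp, planeForm_diag hp']
  by_cases h : m = m'
  · subst h
    rw [if_pos rfl, Pi.single_eq_same]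
    ring
  · rw [if_neg h, Pi.single_eq_of_ne h]
    simp only [planeForm, Prod.fst_zero, Prod.snd_zero]
    ring

theorem sumForm_one_tournamentVector (m : ι) {p : ZMod 2 × ZMod 2} (hp : p.1 + p.2 = 1) :
    sumForm (fun _ => (1, 1)) (tournamentVector T m p) = 1 := by
  rw [tournamentVector, map_add, sumForm_diag, sumForm_comm, sumForm_single, planeForm_diag hp,
    add_zero]

theorem sumQuad_tournamentVector (t : ι → ZMod 2) (m : ι) (hT : T m m = 0) {p : ZMod 2 × ZMod 2}
    (hp : p.1 + p.2 = 1) :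
    sumQuad t (tournamentVector T m p) = t m + ∑ k, T m k := by
  have hmul : ∀ a b : ZMod 2, a + b = 1 → a * b = 0 := by decide
  have hk : ∀ k, planeQuad (t k) (tournamentVector T m p k) =
      (if k = m then t m else 0) + T m k := by
    intro k
    by_cases h : k = m
    · subst h
      simp [tournamentVector, planeQuad, hT, hp, hmul _ _ hp]
    · have hsq : ∀ a b : ZMod 2, a * a + b * (a + a) = a := by decide
      simp [tournamentVector, planeQuad, h, hsq]
  simp only [sumQuad, hk, Finset.sum_add_distrib]
  rw [Finset.sum_ite_eq' Finset.univ m, if_pos (Finset.mem_univ _)]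

/-- Two vectors for each vertex of a tournament. -/
def tournamentFamily (T : ι → ι → ZMod 2) : ι ⊕ ι → ι → ZMod 2 × ZMod 2 :=
  Sum.elim (fun m => tournamentVector T m (1, 0)) (fun m => tournamentVector T m (0, 1))

theorem sumForm_tournamentFamily (hT : ∀ i j, i ≠ j → T i j + T j i = 1) (a b : ι ⊕ ι)
    (hab : a ≠ b) : sumForm (tournamentFamily T a) (tournamentFamily T b) = 1 := by
  have hself : ∀ i, T i i + T i i = 0 := fun i => CharTwo.add_self_eq_zero _
  rcases a with m | m <;> rcases b with m' | m' <;>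
    simp only [tournamentFamily, Sum.elim_inl, Sum.elim_inr] <;>
    rw [sumForm_tournamentVector _ _ (by simp) (by simp)] <;>
    by_cases h : m = m' <;> simp_all [planeForm]

theorem sumQuad_tournamentFamily (t : ι → ZMod 2) (hT : ∀ i, T i i = 0) (a : ι ⊕ ι) :
    sumQuad t (tournamentFamily T a) =
      t (a.elim id id) + ∑ k, T (a.elim id id) k := by
  rcases a with m | m
  · exact sumQuad_tournamentVector t m (hT m) (by simp)
  · exact sumQuad_tournamentVector t m (hT m) (by simp)

end Vectors

/-! ### Algebras with a Pauli basis as Clifford algebras -/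

section Main

variable {K : Type u} {A : Type v} [Field K] [Ring A] [Algebra K A] {n : ℕ} {t : Fin n → ZMod 2}
  {σ : KInvolution K A} {e : Module.Basis (Fin n → ZMod 2 × ZMod 2) K A}

theorem card_fin_sum_fin (n : ℕ) : Fintype.card (Fin n ⊕ Fin n) = 2 * n := by
  rw [Fintype.card_sum, Fintype.card_fin, two_mul]

theorem even_card_fin_sum_fin (n : ℕ) : Even (Fintype.card (Fin n ⊕ Fin n)) :=
  card_fin_sum_fin n ▸ even_two_mul n

theorem card_fin_sum_fin_eq_finrank (n : ℕ) : Fintype.card (Fin n ⊕ Fin n) =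
    Module.finrank (ZMod 2) (Fin n → ZMod 2 × ZMod 2) := by
  rw [card_fin_sum_fin, Module.finrank_pi_fintype]
  simp [mul_comm]

/-- The symmetric and skew-symmetric generating families come from the tournaments with
out-degrees `t` and `t + 1`. -/
theorem IsPauliBasis.isCliffordId_and_isCliffordNegId
    (he : IsPauliBasis (fun v w => sumForm v w) (sumQuad t) σ e) (h2 : (2 : K) ≠ 0) (hn : 0 < n)
    (heven : Even n) (ht : ∑ k, t k = (n.choose 2 : ℕ)) :
    IsCliffordId (2 * n) σ ∧ IsCliffordNegId (2 * n) σ := by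
  rw [← card_fin_sum_fin]
  constructor
  · obtain ⟨T, hT₀, hT, hd⟩ := exists_tournament hn t ht
    refine he.isCliffordId h2 sumForm_isAlt (even_card_fin_sum_fin n)
      (card_fin_sum_fin_eq_finrank n) (sumForm_tournamentFamily hT) fun a => ?_
    rw [sumQuad_tournamentFamily t hT₀, hd]
    exact CharTwo.add_self_eq_zero _
  · obtain ⟨T, hT₀, hT, hd⟩ := exists_tournament hn (fun k => t k + 1) (by
      rw [Finset.sum_add_distrib, ht, Finset.sum_const, Finset.card_univ, Fintype.card_fin,
        nsmul_one, ZMod.natCast_eq_zero_iff_even.mpr heven, add_zero])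
    refine he.isCliffordNegId h2 sumForm_isAlt (even_card_fin_sum_fin n)
      (card_fin_sum_fin_eq_finrank n) (sumForm_tournamentFamily hT) fun a => ?_
    rw [sumQuad_tournamentFamily t hT₀, hd, ← add_assoc, CharTwo.add_self_eq_zero, zero_add]

/-- A tournament makes all generators symmetric except the two attached to one vertex, and one of
these is then replaced by the vector all of whose components are `(1, 1)`. -/
theorem IsPauliBasis.isCliffordReflection_of_sum_eq
    (he : IsPauliBasis (fun v w => sumForm v w) (sumQuad t) σ e) (h2 : (2 : K) ≠ 0) (hn : 0 < n)
    (heven : Even n) (ht : ∑ k, t k = (n.choose 2 : ℕ) + 1) :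
    IsCliffordReflection (2 * n) σ := by
  rw [← card_fin_sum_fin]
  let z : Fin n := ⟨0, hn⟩
  obtain ⟨T, hT₀, hT, hd⟩ := exists_tournament hn (fun k => t k + if k = z then 1 else 0) (by
    rw [Finset.sum_add_distrib, ht, Finset.sum_ite_eq' Finset.univ z, if_pos (Finset.mem_univ _),
      add_assoc, CharTwo.add_self_eq_zero, add_zero])
  let v : Fin n ⊕ Fin n → Fin n → ZMod 2 × ZMod 2 :=
    Function.update (tournamentFamily T) (Sum.inr z) fun _ => (1, 1)
  have hvz : v (Sum.inr z) = fun _ => (1, 1) := Function.update_self ..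
  have hv : ∀ {a}, a ≠ Sum.inr z → v a = tournamentFamily T a := fun h =>
    Function.update_of_ne h ..
  have hone : ∀ a, sumForm (fun _ => (1, 1)) (tournamentFamily T a) = 1 := by
    rintro (m | m) <;> exact sumForm_one_tournamentVector m (by simp)
  refine he.isCliffordReflection h2 sumForm_isAlt (even_card_fin_sum_fin n)
    (card_fin_sum_fin_eq_finrank n) (v := v) (fun a b hab => ?_) (Sum.inl z) fun a => ?_
  · by_cases ha : a = Sum.inr z
    · subst ha
      rw [hvz, hv hab.symm, hone]
    · by_cases hb : b = Sum.inr z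
      · subst hb
        rw [hvz, hv ha, sumForm_comm, hone]
      · rw [hv ha, hv hb, sumForm_tournamentFamily hT a b hab]
  · by_cases ha : a = Sum.inr z
    · subst ha
      rw [hvz, sumQuad_one, Fintype.card_fin,
        ZMod.natCast_eq_zero_iff_even.mpr heven, if_neg Sum.inr_ne_inl]
    · rw [hv ha, sumQuad_tournamentFamily t hT₀, hd, ← add_assoc,
        CharTwo.add_self_eq_zero, zero_add]
      rcases a with m | m
      · by_cases hm : m = z <;> simp [hm]
      · have hm : m ≠ z := fun h => ha (by rw [h])
        simp [hm]

theorem natCast_choose_two_of_mod_four_eq_zero (h : n % 4 = 0) :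
    ((n.choose 2 : ℕ) : ZMod 2) = 0 := by
  obtain ⟨m, rfl⟩ : ∃ m, n = 4 * m := ⟨n / 4, by omega⟩
  rw [ZMod.natCast_eq_zero_iff_even, Nat.choose_two_right,
    show 4 * m * (4 * m - 1) = 2 * (2 * (m * (4 * m - 1))) by ring,
    Nat.mul_div_cancel_left _ two_pos]
  exact even_two_mul _

theorem natCast_choose_two_of_mod_four_eq_two (h : n % 4 = 2) :
    ((n.choose 2 : ℕ) : ZMod 2) = 1 := by
  obtain ⟨m, rfl⟩ : ∃ m, n = 4 * m + 2 := ⟨n / 4, by omega⟩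
  rw [ZMod.natCast_eq_one_iff_odd, Nat.choose_two_right,
    show (4 * m + 2) * (4 * m + 2 - 1) = 2 * ((2 * m + 1) * (4 * m + 1)) by
      rw [show 4 * m + 2 - 1 = 4 * m + 1 by omega]; ring,
    Nat.mul_div_cancel_left _ two_pos]
  exact Odd.mul ⟨m, rfl⟩ ⟨2 * m, by ring⟩

end Main

end

theorem proposition6p8 {K : Type u} [Field K] (h2 : (2 : K) ≠ 0) (n : ℕ) (hn : 0 < n)
    (heven : Even n) (Q : Fin n → Type v) [∀ i, Ring (Q i)] [∀ i, Algebra K (Q i)]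
    (hQ : ∀ i, IsQuaternionAlgebra K (Q i)) (σ : ∀ i, KInvolution K (Q i)) :
    (n % 4 = 0 → (KInvolution.piTensor σ).IsOrthogonal →
      IsCliffordId (2 * n) (KInvolution.piTensor σ) ∧
        IsCliffordNegId (2 * n) (KInvolution.piTensor σ)) ∧
    (n % 4 = 0 → (KInvolution.piTensor σ).IsSymplectic →
      IsCliffordReflection (2 * n) (KInvolution.piTensor σ)) ∧
    (n % 4 = 2 → (KInvolution.piTensor σ).IsSymplectic →
      IsCliffordId (2 * n) (KInvolution.piTensor σ) ∧
        IsCliffordNegId (2 * n) (KInvolution.piTensor σ)) ∧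
    (n % 4 = 2 → (KInvolution.piTensor σ).IsOrthogonal →
      IsCliffordReflection (2 * n) (KInvolution.piTensor σ)) := by
  choose t e he' using fun i => exists_isPauliBasis_factor h2 (hQ i) (σ i)
  have he := IsPauliBasis.piTensor he'
  have horth : (KInvolution.piTensor σ).IsOrthogonal → ∑ k, t k = 0 := by
    rintro ⟨L, _, _, V, _, _, _, φ, b, hb, hsymm, hadj⟩
    exact he.signChar_sum_eq h2 hb hadj 0 fun x y => by
      rw [signChar_zero, one_mul, hsymm.eq]
  have hsymp : (KInvolution.piTensor σ).IsSymplectic → ∑ k, t k = 1 := by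
    rintro ⟨L, _, _, V, _, _, _, φ, b, hb, halt, hadj⟩
    exact he.signChar_sum_eq h2 hb hadj 1 fun x y => by
      rw [signChar_one, neg_one_mul, halt.neg_eq]
  refine ⟨fun h4 h => ?_, fun h4 h => ?_, fun h4 h => ?_, fun h4 h => ?_⟩
  · refine he.isCliffordId_and_isCliffordNegId h2 hn heven ?_
    rw [horth h, natCast_choose_two_of_mod_four_eq_zero h4]
  · refine he.isCliffordReflection_of_sum_eq h2 hn heven ?_
    rw [hsymp h, natCast_choose_two_of_mod_four_eq_zero h4, zero_add]
  · refine he.isCliffordId_and_isCliffordNegId h2 hn heven ?_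
    rw [hsymp h, natCast_choose_two_of_mod_four_eq_two h4]
  · refine he.isCliffordReflection_of_sum_eq h2 hn heven ?_
    rw [horth h, natCast_choose_two_of_mod_four_eq_two h4]
    exact (CharTwo.add_self_eq_zero 1).symm
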